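/- Let $p$ be a prime and let $k\geqslant 1$ be an integer. A group $H$ is said to be self-similar of index $m$ if it admits a faithful action by automorphisms on the regular rooted $m$-ary tree (whose vertices are the finite words over an alphabet $X$ with $m$ letters) that is transitive on the first level and self-similar, i.e. for all $g\in H$ and $x\in X$ there are $y\in X$ and $h\in H$ such that $g(xw)=y\,h(w)$ for all words $w$. A finitely generated pro-$p$ group $G$ is said to be strongly hereditarily self-similar of index $p^k$ if $G$ and all of its non-trivial finitely generated closed subgroups are self-similar of index $p^k$ (here "finitely generated" means topologically finitely generated). Let $G$ be a topological group isomorphic to one of the following groups: (1) the abelian pro-$p$ group $\mathbb{Z}_p^d$, for an integer $d\geqslant 1$; (2) the metabelian pro-$p$ group $G^d(s)=\mathbb{Z}_p\ltimes\mathbb{Z}_p^{d-1}$, for an integer $d\geqslant 2$, where the canonical generator of $\mathbb{Z}_p$ acts on $\mathbb{Z}_p^{d-1}$ by multiplication by the scalar $1+p^s$ for some integer $s$ such that $s\geqslant 1$ if $p\geqslant 3$, and $s\geqslant 2$ if $p=2$. Then $G$ is a finitely generated pro-$p$ group that is strongly hereditarily self-similar of index $p^k$. -/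

import Mathlib

open Filter Topology

/-- The regular rooted `d`-ary tree: vertices are the finite words over the alphabet `Fin d`,
the root is the empty word, and `v` is joined to each of its children `v ++ [x]`. -/
def regularRootedTree (d : ℕ) : SimpleGraph (List (Fin d)) :=
  SimpleGraph.fromRel fun v w => ∃ x : Fin d, w = v ++ [x]

/-- `G` is self-similar of index `d`: it admits a faithful action on the `d`-ary rooted tree (by
root-fixing graph automorphisms) that is self-similar (for all `g` and all letters `x` there are a
letter `y` and `h ∈ G` with `g (x w) = y (h w)` for all words `w`) and is transitive on the first
level. -/
def IsSelfSimilarOfIndex (G : Type*) [Group G] (d : ℕ) : Prop :=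
  ∃ ρ : G →* (regularRootedTree d ≃g regularRootedTree d),
    Function.Injective ρ ∧
    (∀ g : G, ρ g [] = []) ∧
    (∀ (g : G) (x : Fin d), ∃ (y : Fin d) (h : G), ∀ w : List (Fin d),
      ρ g (x :: w) = y :: ρ h w) ∧
    (∀ x y : Fin d, ∃ g : G, ρ g [x] = [y])

/-- `G` is finitely generated as a topological group. -/
def IsTopologicallyFG (G : Type*) [Group G] [TopologicalSpace G] : Prop :=
  ∃ S : Finset G, Dense (Subgroup.closure (S : Set G) : Set G)

/-- `G` is a pro-`p` group: a profinite group all of whose open normal subgroups have index a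
power of `p`. -/
structure IsProPGroup (p : ℕ) (G : Type*) [Group G] [TopologicalSpace G] : Prop where
  isTopologicalGroup : IsTopologicalGroup G
  compactSpace : CompactSpace G
  t2Space : T2Space G
  totallyDisconnectedSpace : TotallyDisconnectedSpace G
  index_eq_pow : ∀ U : Subgroup G, U.Normal → IsOpen (U : Set G) → ∃ n : ℕ, U.index = p ^ n

/-- `G` is a finitely generated pro-`p` group such that `G` and all of its non-trivial
(topologically) finitely generated closed subgroups are self-similar of index `p ^ k`. -/
structure IsStronglyHereditarilySelfSimilar (p k : ℕ) (G : Type*) [Group G]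
    [TopologicalSpace G] : Prop where
  isProPGroup : IsProPGroup p G
  isTopologicallyFG : IsTopologicallyFG G
  isSelfSimilar : IsSelfSimilarOfIndex G (p ^ k)
  isSelfSimilar_subgroup : ∀ H : Subgroup G, IsClosed (H : Set G) → H ≠ ⊥ →
    IsTopologicallyFG H → IsSelfSimilarOfIndex H (p ^ k)

section Semidirect

theorem padicInt_tendsto_pow_pow (p : ℕ) [Fact p.Prime] {s : ℕ} (hs : 1 ≤ s) :
    Tendsto (fun n : ℕ => ((p : ℤ_[p]) ^ s) ^ n) atTop (𝓝 0) := by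
  rw [tendsto_pow_atTop_nhds_zero_iff_norm_lt_one, norm_pow]
  exact pow_lt_one₀ (norm_nonneg _) (by
    rw [PadicInt.norm_p]
    exact inv_lt_one_of_one_lt₀ (by exact_mod_cast (Fact.out : p.Prime).one_lt)) (by omega)

/-- The continuous character `t ↦ (1 + p ^ s) ^ t` of `ℤ_[p]`. -/
noncomputable def onePlusPowChar (p : ℕ) [Fact p.Prime] (s : ℕ) (hs : 1 ≤ s) :
    AddChar ℤ_[p] ℤ_[p] :=
  PadicInt.addChar_of_value_at_one ((p : ℤ_[p]) ^ s) (padicInt_tendsto_pow_pow p hs)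

theorem onePlusPowChar_one (p : ℕ) [Fact p.Prime] (s : ℕ) (hs : 1 ≤ s) :
    onePlusPowChar p s hs 1 = 1 + (p : ℤ_[p]) ^ s :=
  PadicInt.addChar_of_value_at_one_def _

theorem continuous_onePlusPowChar (p : ℕ) [Fact p.Prime] (s : ℕ) (hs : 1 ≤ s) :
    Continuous (onePlusPowChar p s hs) :=
  PadicInt.continuous_addChar_of_value_at_one _

/-- The action of `ℤ_[p]` on `ℤ_[p] ^ n` (written multiplicatively) in which `t` acts as
multiplication by the scalar `(1 + p ^ s) ^ t`. -/
noncomputable def scalarAction (p : ℕ) [Fact p.Prime] (n s : ℕ) (hs : 1 ≤ s) :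
    Multiplicative ℤ_[p] →* MulAut (Multiplicative (Fin n → ℤ_[p])) where
  toFun t :=
    { toFun := fun v => .ofAdd (onePlusPowChar p s hs t.toAdd • v.toAdd)
      invFun := fun v => .ofAdd (onePlusPowChar p s hs (-t.toAdd) • v.toAdd)
      left_inv := fun v => by
        simp [smul_smul, ← AddChar.map_add_eq_mul]
      right_inv := fun v => by
        simp [smul_smul, ← AddChar.map_add_eq_mul]
      map_mul' := fun v w => by simp [smul_add] }
  map_one' := by
    ext v : 1
    simp
  map_mul' t u := by
    ext v : 1
    simp [AddChar.map_add_eq_mul, smul_smul]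

/-- The canonical generator of `ℤ_[p]` acts as multiplication by `1 + p ^ s`. -/
theorem scalarAction_generator (p : ℕ) [Fact p.Prime] (n s : ℕ) (hs : 1 ≤ s)
    (v : Fin n → ℤ_[p]) :
    scalarAction p n s hs (.ofAdd 1) (.ofAdd v) = .ofAdd ((1 + (p : ℤ_[p]) ^ s) • v) := by
  simp [scalarAction, onePlusPowChar_one]

/-- The group `G^d(s) = ℤ_[p] ⋉ ℤ_[p] ^ (d - 1)`, in which the canonical generator of `ℤ_[p]`
acts on `ℤ_[p] ^ (d - 1)` as multiplication by `1 + p ^ s`. It carries the product topology. -/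
noncomputable def MetabelianGroup (p : ℕ) [Fact p.Prime] (d s : ℕ) (hs : 1 ≤ s) : Type :=
  Multiplicative (Fin (d - 1) → ℤ_[p]) ⋊[scalarAction p (d - 1) s hs] Multiplicative ℤ_[p]

noncomputable instance (p : ℕ) [Fact p.Prime] (d s : ℕ) (hs : 1 ≤ s) :
    Group (MetabelianGroup p d s hs) :=
  inferInstanceAs (Group (_ ⋊[scalarAction p (d - 1) s hs] _))

noncomputable instance (p : ℕ) [Fact p.Prime] (d s : ℕ) (hs : 1 ≤ s) :
    TopologicalSpace (MetabelianGroup p d s hs) :=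
  .induced (SemidirectProduct.equivProd (φ := scalarAction p (d - 1) s hs)) inferInstance

end Semidirect

/-! A virtual endomorphism of `H`, defined on a subgroup of index `m`, yields a self-similar action
on the `m`-ary tree, and the action is faithful when no non-trivial normal subgroup is invariant
(`isSelfSimilarOfIndex_of_virtualEndomorphism`).

One family of groups suffices: `ℤ_[p] ^ (n + 1) ⋊ C`, with `C` acting faithfully by scalars. Divide
the first coordinate by `p ^ k`, which is possible on a subgroup of index `p ^ k`, then rotate the
coordinates. Vectors in an invariant normal subgroup can be divided by `p` indefinitely, so they
vanish. Commutators with vectors then force the `C`-part to be trivial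
(`isSelfSimilarOfIndex_scalarExtension`).

Every non-trivial closed subgroup belongs to this family. In `ℤ_[p] ^ d` it is a free
`ℤ_[p]`-module, and `C` is trivial. In `G^d(s)`, a closed `H` either embeds in some `ℤ_[p] ^ m` or
splits as `W ⋊ C`, where `W` is its vector part and `C` centralizes an element whose exponent
generates all exponents of `H` (`isSelfSimilarOfIndex_subgroup_of_ne`). -/

/-! ### Self-similar actions from virtual endomorphisms. -/

section Tree

variable {H K : Type*} [Group H] [Group K] {m : ℕ}

/-- The self-similar action on words determined by a transversal `r` of the image of an injective
homomorphism `ι : K →* H` and a homomorphism `φ : K →* H`; the bijection `e` sends `g` to the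
unique pair `(x, c)` with `g = r x * ι c`. -/
def wordAction (r : Fin m → H) (φ : K →* H) (e : H → Fin m × K) : H → List (Fin m) → List (Fin m)
  | _, [] => []
  | g, x :: w => (e (g * r x)).1 :: wordAction r φ e (φ (e (g * r x)).2) w

variable {r : Fin m → H} {ι φ : K →* H} {e : H → Fin m × K}

/-- Factorizations are unique, so any known factorization of `g * r x` computes the action without
unfolding `e`. -/
theorem wordAction_cons (he : ∀ x c, e (r x * ι c) = (x, c)) {g : H} {x y : Fin m} {c : K}
    (h : g * r x = r y * ι c) (w : List (Fin m)) :
    wordAction r φ e g (x :: w) = y :: wordAction r φ e (φ c) w := by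
  simp [wordAction, h, he]

theorem wordAction_one (he : ∀ x c, e (r x * ι c) = (x, c)) (w : List (Fin m)) :
    wordAction r φ e 1 w = w := by
  induction w with
  | nil => rfl
  | cons x w ih =>
    rw [wordAction_cons he (y := x) (c := 1) (by simp), map_one, ih]

/-- If `g' * r x = r y' * ι c'` and `g * r y' = r y * ι c`, then `g * g' * r x = r y * ι (c * c')`;
multiplicativity of `φ` handles the tail. -/
theorem wordAction_mul (he : ∀ x c, e (r x * ι c) = (x, c))
    (he' : ∀ g, r (e g).1 * ι (e g).2 = g) (w : List (Fin m)) (g g' : H) :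
    wordAction r φ e (g * g') w = wordAction r φ e g (wordAction r φ e g' w) := by
  induction w generalizing g g' with
  | nil => rfl
  | cons x w ih =>
    obtain ⟨y', c', h'⟩ : ∃ y c, g' * r x = r y * ι c := ⟨_, _, (he' _).symm⟩
    obtain ⟨y, c, h⟩ : ∃ y c, g * r y' = r y * ι c := ⟨_, _, (he' _).symm⟩
    rw [wordAction_cons he h', wordAction_cons he h, ← ih, ← map_mul]
    refine wordAction_cons he ?_ w
    rw [mul_assoc, h', ← mul_assoc, h, mul_assoc, map_mul]

/-- This gives preservation of adjacency: children go to children. -/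
theorem wordAction_append (g : H) (v : List (Fin m)) (x : Fin m) :
    ∃ y, wordAction r φ e g (v ++ [x]) = wordAction r φ e g v ++ [y] := by
  induction v generalizing g with
  | nil => exact ⟨_, rfl⟩
  | cons z v ih =>
    obtain ⟨y, hy⟩ := ih (φ (e (g * r z)).2)
    exact ⟨y, by simp [wordAction, hy]⟩

/-- A virtual endomorphism without non-trivial invariant normal subgroups gives a
self-similar action. The virtual endomorphism is `φ ∘ ι⁻¹`, defined on the range of `ι`. -/
theorem isSelfSimilarOfIndex_of_virtualEndomorphism (r : Fin m → H) (ι φ : K →* H)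
    (hbij : Function.Bijective fun q : Fin m × K => r q.1 * ι q.2)
    (hsimple : ∀ N : Subgroup H, N.Normal → (∀ g ∈ N, ∃ c, ι c = g ∧ φ c ∈ N) → N = ⊥) :
    IsSelfSimilarOfIndex H m := by
  let E := Equiv.ofBijective _ hbij
  let e : H → Fin m × K := E.symm
  have he : ∀ x c, e (r x * ι c) = (x, c) := fun x c => E.symm_apply_apply (x, c)
  have he' : ∀ g, r (e g).1 * ι (e g).2 = g := fun g => E.apply_symm_apply g
  have hcancel : ∀ (g : H) (w), wordAction r φ e g⁻¹ (wordAction r φ e g w) = w := fun g w => by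
    rw [← wordAction_mul he he', inv_mul_cancel, wordAction_one he]
  have hcancel' : ∀ (g : H) (w), wordAction r φ e g (wordAction r φ e g⁻¹ w) = w := fun g w => by
    rw [← wordAction_mul he he', mul_inv_cancel, wordAction_one he]
  have hadj : ∀ (g : H) {v w}, (regularRootedTree m).Adj v w →
      (regularRootedTree m).Adj (wordAction r φ e g v) (wordAction r φ e g w) := by
    rintro g v w ⟨hne, h⟩
    refine ⟨(Function.LeftInverse.injective (hcancel g)).ne hne, h.imp ?_ ?_⟩ <;>
    · rintro ⟨x, rfl⟩
      exact wordAction_append g _ x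
  let ρ : H →* (regularRootedTree m ≃g regularRootedTree m) :=
    { toFun := fun g =>
        { toFun := wordAction r φ e g
          invFun := wordAction r φ e g⁻¹
          left_inv := hcancel g
          right_inv := hcancel' g
          map_rel_iff' := fun {v w} => ⟨fun h => by
            have := hadj g⁻¹ h
            simpa [hcancel] using this, hadj g⟩ }
      map_one' := by
        ext w : 1
        exact wordAction_one he w
      map_mul' := fun g g' => by
        ext w : 1
        exact wordAction_mul he he' w g g' }
  have hρ : ∀ g w, ρ g w = wordAction r φ e g w := fun _ _ => rfl
  refine ⟨ρ, ?_, fun g => rfl, fun g x => ⟨_, _, fun w => rfl⟩, fun x y => ?_⟩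
  · rw [← MonoidHom.ker_eq_bot_iff]
    refine hsimple _ inferInstance fun g hg => ?_
    -- Any letter would do; factoring `1` merely provides one.
    let x := (e 1).1
    have hconj := (inferInstance : ρ.ker.Normal).conj_mem g hg (r x)
    have hfix : ∀ w, wordAction r φ e (r x * g * (r x)⁻¹) w = w := fun w => by
      rw [← hρ, MonoidHom.mem_ker.mp hconj]
      rfl
    have hx := he' (r x * g)
    -- Since `r x * g * (r x)⁻¹` acts trivially, comparing heads puts `g` in the range of `ι`, and
    -- comparing tails puts its image under `φ ∘ ι⁻¹` in the kernel.
    have hcons : ∀ w, x :: w = (e (r x * g)).1 :: wordAction r φ e (φ (e (r x * g)).2) w :=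
      fun w => by
        rw [← wordAction_cons he (g := r x * g * (r x)⁻¹) (x := x) (by rw [hx]; group), hfix]
    refine ⟨(e (r x * g)).2, ?_, ?_⟩
    · rw [← (List.cons.inj (hcons [])).1] at hx
      exact mul_left_cancel hx
    · rw [MonoidHom.mem_ker]
      ext w : 1
      exact (List.cons.inj (hcons w)).2.symm
  · refine ⟨r y * (r x)⁻¹, ?_⟩
    rw [hρ, wordAction_cons he (y := y) (c := 1) (by simp)]
    rfl

theorem IsSelfSimilarOfIndex.of_mulEquiv (f : H ≃* K) (h : IsSelfSimilarOfIndex H m) :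
    IsSelfSimilarOfIndex K m := by
  obtain ⟨ρ, hinj, hroot, hself, htrans⟩ := h
  refine ⟨ρ.comp f.symm.toMonoidHom, hinj.comp f.symm.injective, fun g => hroot _,
    fun g x => ?_, fun x y => ?_⟩
  · obtain ⟨y, h, hw⟩ := hself (f.symm g) x
    exact ⟨y, f h, fun w => by simpa using hw w⟩
  · obtain ⟨g, hg⟩ := htrans x y
    exact ⟨f g, by simpa using hg⟩

end Tree

/-! ### Self-similarity of `ℤ_[p] ^ (n + 1) ⋊ C` with scalar action. -/

section ScalarExtension

variable {p : ℕ} [Fact p.Prime] {n s : ℕ} {hs : 1 ≤ s} {C : Type*} [Group C]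

/-- The endomorphism of `ℤ_[p] ^ n ⋊ C` induced by a linear endomorphism of `ℤ_[p] ^ n`, where `C`
acts by scalars. -/
noncomputable def scalarSemidirectMap (f : C →* Multiplicative ℤ_[p])
    (L : (Fin n → ℤ_[p]) →ₗ[ℤ_[p]] (Fin n → ℤ_[p])) :
    Multiplicative (Fin n → ℤ_[p]) ⋊[(scalarAction p n s hs).comp f] C →*
      Multiplicative (Fin n → ℤ_[p]) ⋊[(scalarAction p n s hs).comp f] C :=
  SemidirectProduct.map L.toAddMonoidHom.toMultiplicative (MonoidHom.id C) fun c => by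
    refine MonoidHom.ext fun v => ?_
    exact congrArg Multiplicative.ofAdd (L.map_smul _ v.toAdd)

/-- Existence in division with remainder by `p ^ k`; uniqueness is
`PadicInt.natCast_add_pow_mul_inj`. Together they make the multiples `0, …, p ^ k - 1` of the first
basis vector a transversal. -/
theorem PadicInt.existsUnique_natCast_add_pow_mul (k : ℕ) (a : ℤ_[p]) :
    ∃ (x : Fin (p ^ k)) (b : ℤ_[p]), (x : ℤ_[p]) + (p : ℤ_[p]) ^ k * b = a := by
  obtain ⟨b, hb⟩ := Ideal.mem_span_singleton.mp (PadicInt.appr_spec k a)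
  exact ⟨⟨a.appr k, a.appr_lt k⟩, b, by rw [← hb]; ring⟩

theorem PadicInt.natCast_add_pow_mul_inj {k : ℕ} {x y : Fin (p ^ k)} {a b : ℤ_[p]}
    (h : (x : ℤ_[p]) + (p : ℤ_[p]) ^ k * a = (y : ℤ_[p]) + (p : ℤ_[p]) ^ k * b) :
    x = y ∧ a = b := by
  have hp : (p : ℤ_[p]) ^ k ≠ 0 := pow_ne_zero _ (by exact_mod_cast (Fact.out : p.Prime).ne_zero)
  have hxy : x = y := by
    have h' := congrArg (PadicInt.toZModPow k) h
    have hz : ((p : ZMod (p ^ k)) ^ k) = 0 := by exact_mod_cast ZMod.natCast_self (p ^ k)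
    simp only [map_add, map_mul, map_pow, map_natCast, hz, zero_mul, add_zero] at h'
    rw [ZMod.natCast_eq_natCast_iff', Nat.mod_eq_of_lt x.2, Nat.mod_eq_of_lt y.2] at h'
    exact Fin.ext h'
  subst hxy
  exact ⟨rfl, mul_left_cancel₀ hp (add_left_cancel h)⟩

theorem PadicInt.eq_zero_of_forall_pow_dvd {a : ℤ_[p]} (h : ∀ j : ℕ, (p : ℤ_[p]) ^ j ∣ a) :
    a = 0 := by
  by_contra ha
  have hle := (PadicInt.mem_span_pow_iff_le_valuation a ha (a.valuation + 1)).mp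
    (Ideal.mem_span_singleton.mpr (h _))
  omega

/-- A set of vectors that is invariant under the cyclic shift composed with division of the
first coordinate by `p ^ k` is trivial. -/
theorem eq_zero_of_shift_invariant {k : ℕ} (hk : 1 ≤ k) {V : Set (Fin (n + 1) → ℤ_[p])}
    (hV : ∀ w ∈ V, ∃ v : Fin (n + 1) → ℤ_[p],
      (Function.update 1 0 ((p : ℤ_[p]) ^ k) : Fin (n + 1) → ℤ_[p]) * v = w ∧ v ∘ finRotate (n + 1) ∈ V)
    {w : Fin (n + 1) → ℤ_[p]} (hw : w ∈ V) : w = 0 := by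
  -- Double induction, on the power of `p` and on the coordinate: rotation brings coordinate `i + 1`
  -- to position `i` and coordinate `0` to the last position. Only passing through coordinate `0`
  -- gains a factor `p ^ k`, hence at least one `p`.
  have key : ∀ (j : ℕ), ∀ w ∈ V, ∀ i, (p : ℤ_[p]) ^ j ∣ w i := by
    intro j
    induction j with
    | zero => simp
    | succ j ih =>
      intro w hw i
      induction i using Fin.induction generalizing w with
      | zero =>
        obtain ⟨v, rfl, hv⟩ := hV w hw
        have h := ih _ hv (Fin.last n)
        rw [Function.comp_apply, finRotate_last] at h
        rw [Pi.mul_apply, Function.update_self, pow_succ']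
        exact mul_dvd_mul (dvd_pow_self _ (by omega)) h
      | succ i ihi =>
        obtain ⟨v, rfl, hv⟩ := hV w hw
        have h := ihi _ hv
        rw [Function.comp_apply, finRotate_apply, Fin.coeSucc_eq_succ] at h
        simpa [Function.update_of_ne (Fin.succ_ne_zero i)] using h
  exact funext fun i => PadicInt.eq_zero_of_forall_pow_dvd fun j => key j w hw i

/-- The virtual endomorphism is `S ∘ D⁻¹`, extended by the identity on `C`; scalars commute with
linear maps, so `D` and `S` both extend to the semidirect product. The hypothesis `hf` says that `C`
acts faithfully. -/
theorem isSelfSimilarOfIndex_scalarExtension {k : ℕ} (hk : 1 ≤ k)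
    (f : C →* Multiplicative ℤ_[p])
    (hf : ∀ c, onePlusPowChar p s hs (f c).toAdd = 1 → c = 1) :
    IsSelfSimilarOfIndex
      (Multiplicative (Fin (n + 1) → ℤ_[p]) ⋊[(scalarAction p (n + 1) s hs).comp f] C) (p ^ k) := by
  let D : (Fin (n + 1) → ℤ_[p]) →ₗ[ℤ_[p]] (Fin (n + 1) → ℤ_[p]) :=
    LinearMap.mulLeft ℤ_[p] (Function.update 1 0 ((p : ℤ_[p]) ^ k))
  let S : (Fin (n + 1) → ℤ_[p]) →ₗ[ℤ_[p]] (Fin (n + 1) → ℤ_[p]) :=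
    LinearMap.funLeft ℤ_[p] ℤ_[p] (finRotate (n + 1))
  have hD0 : ∀ v, D v 0 = (p : ℤ_[p]) ^ k * v 0 := fun v => by simp [D]
  have hD : ∀ v i, i ≠ 0 → D v i = v i := fun v i hi => by simp [D, Function.update_of_ne hi]
  refine isSelfSimilarOfIndex_of_virtualEndomorphism
    (fun x => SemidirectProduct.inl (.ofAdd (Pi.single 0 ((x : ℕ) : ℤ_[p]))))
    (scalarSemidirectMap f D) (scalarSemidirectMap f S) ⟨?_, ?_⟩ fun N hN hinv => ?_
  · rintro ⟨x, v, c⟩ ⟨y, w, c'⟩ h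
    have hl : Pi.single 0 ((x : ℕ) : ℤ_[p]) + D v.toAdd = Pi.single 0 ((y : ℕ) : ℤ_[p]) + D w.toAdd := by
      have h1 := congrArg SemidirectProduct.left h
      simpa [scalarSemidirectMap, ← ofAdd_add] using h1
    have hr : c = c' := by
      have h1 := congrArg SemidirectProduct.right h
      simpa [scalarSemidirectMap] using h1
    have h0 := congrFun hl 0
    simp only [Pi.add_apply, Pi.single_eq_same, hD0] at h0
    obtain ⟨rfl, h0'⟩ := PadicInt.natCast_add_pow_mul_inj h0
    have hvw : v = w := by
      refine Multiplicative.toAdd.injective (funext fun i => ?_)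
      by_cases hi : i = 0
      · rw [hi, h0']
      · simpa [hD, hi] using congrFun hl i
    rw [hvw, hr]
  · rintro ⟨v, c⟩
    obtain ⟨x, b, hb⟩ := PadicInt.existsUnique_natCast_add_pow_mul k (v.toAdd 0)
    refine ⟨⟨x, .ofAdd (Function.update v.toAdd 0 b), c⟩, ?_⟩
    refine SemidirectProduct.ext (Multiplicative.toAdd.injective (funext fun i => ?_)) ?_
    · have h1 : (Pi.single 0 ((x : ℕ) : ℤ_[p]) + D (Function.update v.toAdd 0 b) :
          Fin (n + 1) → ℤ_[p]) i = v.toAdd i := by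
        by_cases hi : i = 0
        · subst hi
          simp [hD0, hb]
        · simp [hD, hi]
      simpa [scalarSemidirectMap] using h1
    · simp [scalarSemidirectMap]
  · have hinl : ∀ v, SemidirectProduct.inl (.ofAdd v) ∈ N → v = 0 := by
      intro v hv
      refine eq_zero_of_shift_invariant hk (V := {v | (SemidirectProduct.inl (.ofAdd v) :
        _ ⋊[(scalarAction p (n + 1) s hs).comp f] C) ∈ N}) ?_ hv
      intro w hw
      obtain ⟨⟨v, c⟩, h1, h2⟩ := hinv _ hw
      have hc : c = 1 := by
        simpa [scalarSemidirectMap] using congrArg SemidirectProduct.right h1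
      subst hc
      exact ⟨v.toAdd, Multiplicative.ofAdd.injective (congrArg SemidirectProduct.left h1), h2⟩
    rw [Subgroup.eq_bot_iff_forall]
    rintro ⟨v, c⟩ hg
    -- The commutator of `(v, c)` with the vector `w` lies in `N` and equals the vector `(χ - 1) •
    -- w`, where `χ` is the scalar by which `c` acts.
    have hcomm : ∀ w : Fin (n + 1) → ℤ_[p], onePlusPowChar p s hs (f c).toAdd • w - w = 0 := by
      intro w
      refine hinl _ ?_
      have h1 := N.mul_mem hg (hN.conj_mem _ (N.inv_mem hg) (SemidirectProduct.inl (.ofAdd w)))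
      convert h1 using 1
      rw [mul_assoc, ← mul_assoc, ← mul_assoc, eq_mul_inv_iff_mul_eq,
        eq_mul_inv_iff_mul_eq]
      refine SemidirectProduct.ext (Multiplicative.toAdd.injective ?_) ?_
      · have h2 : (onePlusPowChar p s hs (f c).toAdd • w - w) + w + v.toAdd =
            v.toAdd + onePlusPowChar p s hs (f c).toAdd • w := by abel
        simp only [SemidirectProduct.mul_left, SemidirectProduct.mul_right,
          SemidirectProduct.left_inl, SemidirectProduct.right_inl, map_one, one_mul,
          MulAut.one_apply, toAdd_mul, toAdd_ofAdd]
        exact h2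
      · simp
    have hc : c = 1 := by
      refine hf c ?_
      have h1 := congrFun (hcomm 1) 0
      simpa [sub_eq_zero] using h1
    subst hc
    have hv := hinl v.toAdd hg
    exact SemidirectProduct.ext (Multiplicative.toAdd.injective hv) rfl

end ScalarExtension

/-! ### Closed subgroups of `ℤ_[p] ^ d` and injectivity of the character. -/

section ClosedSubgroup

variable {p : ℕ} [Fact p.Prime]

/-- A closed additive subgroup of a topological `ℤ_[p]`-module is a submodule. -/
theorem PadicInt.smul_mem_of_isClosed {M : Type*} [AddCommGroup M] [Module ℤ_[p] M]
    [TopologicalSpace M] [ContinuousSMul ℤ_[p] M] {E : AddSubgroup M} (hE : IsClosed (E : Set M))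
    (z : ℤ_[p]) {v : M} (hv : v ∈ E) : z • v ∈ E := by
  refine PadicInt.denseRange_intCast.induction_on (p := fun z : ℤ_[p] => z • v ∈ E) z
    (hE.preimage (continuous_id.smul continuous_const)) fun a => ?_
  rw [Int.cast_smul_eq_zsmul]
  exact E.zsmul_mem hv a

/-- The submodule given by a closed additive subgroup of a topological `ℤ_[p]`-module. -/
def PadicInt.submoduleOfIsClosed {M : Type*} [AddCommGroup M] [Module ℤ_[p] M]
    [TopologicalSpace M] [ContinuousSMul ℤ_[p] M] (E : AddSubgroup M)
    (hE : IsClosed (E : Set M)) : Submodule ℤ_[p] M :=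
  { E with smul_mem' := fun z _ hv => PadicInt.smul_mem_of_isClosed hE z hv }

/-- The kernel is closed, hence an ideal. A non-zero ideal contains some `p ^ j`, which would give
`(1 + p ^ s) ^ p ^ j = 1`, already impossible in `ℕ`. -/
theorem eq_zero_of_onePlusPowChar_eq_one {s : ℕ} {hs : 1 ≤ s} {t : ℤ_[p]}
    (h : onePlusPowChar p s hs t = 1) : t = 0 := by
  let E : AddSubgroup ℤ_[p] :=
    { carrier := {t | onePlusPowChar p s hs t = 1}
      zero_mem' := by simp
      add_mem' := fun {a b} (ha : _ = _) (hb : _ = _) => by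
        change onePlusPowChar p s hs (a + b) = 1
        rw [AddChar.map_add_eq_mul, ha, hb, one_mul]
      neg_mem' := fun {a} (ha : _ = _) => by
        change onePlusPowChar p s hs (-a) = 1
        have h1 := AddChar.map_add_eq_mul (onePlusPowChar p s hs) (-a) a
        rwa [neg_add_cancel, AddChar.map_zero_eq_one, ha, mul_one, eq_comm] at h1 }
  have hE : IsClosed (E : Set ℤ_[p]) :=
    isClosed_eq (continuous_onePlusPowChar p s hs) continuous_const
  by_contra ht
  have hpow : (p : ℤ_[p]) ^ t.valuation ∈ E := by
    have hmem := PadicInt.smul_mem_of_isClosed hE (((PadicInt.unitCoeff ht)⁻¹ : ℤ_[p]ˣ) : ℤ_[p]) h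
    rwa [smul_eq_mul, (Units.inv_mul_eq_iff_eq_mul _).mpr (PadicInt.unitCoeff_spec ht)] at hmem
  have h1 : onePlusPowChar p s hs ((p : ℤ_[p]) ^ t.valuation) = 1 := hpow
  have h2 : (p : ℤ_[p]) ^ t.valuation = (p ^ t.valuation) • (1 : ℤ_[p]) := by simp
  rw [h2, AddChar.map_nsmul_eq_pow, onePlusPowChar_one] at h1
  have h3 : (1 + p ^ s) ^ p ^ t.valuation = 1 := by exact_mod_cast h1
  have hp := (Fact.out : p.Prime).pos
  rcases Nat.pow_eq_one.mp h3 with h4 | h4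
  · have := Nat.pow_pos (n := s) hp
    omega
  · exact (Nat.pow_pos hp).ne' h4

/-- A non-trivial submodule of `ℤ_[p] ^ d` is isomorphic to some `ℤ_[p] ^ (n + 1)`. -/
theorem exists_linearEquiv_succ {d : ℕ} (W : Submodule ℤ_[p] (Fin d → ℤ_[p])) (hW : W ≠ ⊥) :
    ∃ n : ℕ, Nonempty ((Fin (n + 1) → ℤ_[p]) ≃ₗ[ℤ_[p]] W) := by
  have b := Module.finBasis ℤ_[p] W
  have : Nontrivial W := Submodule.nontrivial_iff_ne_bot.mpr hW
  obtain ⟨n, hn⟩ := Nat.exists_eq_succ_of_ne_zero (Module.finrank_pos (R := ℤ_[p]) (M := W)).ne'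
  exact ⟨n, ⟨(b.reindex (finCongr hn)).equivFun.symm⟩⟩

theorem isSelfSimilarOfIndex_multiplicative {k : ℕ} (hk : 1 ≤ k) (n : ℕ) :
    IsSelfSimilarOfIndex (Multiplicative (Fin (n + 1) → ℤ_[p])) (p ^ k) := by
  -- With `C` trivial the scalar action plays no role, so the value `s = 1` is arbitrary.
  refine (isSelfSimilarOfIndex_scalarExtension (n := n) (s := 1) (hs := le_rfl) hk
    (1 : Unit →* Multiplicative ℤ_[p]) fun c _ => rfl).of_mulEquiv
    (MulEquiv.ofBijective SemidirectProduct.inl ⟨SemidirectProduct.inl_injective, ?_⟩).symm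
  exact fun x => ⟨x.left, SemidirectProduct.ext rfl rfl⟩

/-- A group that embeds in `ℤ_[p] ^ d` with closed image is self-similar unless trivial. -/
theorem isSelfSimilarOfIndex_of_injective {k d : ℕ} (hk : 1 ≤ k) {H : Type*} [Group H]
    [Nontrivial H] (f : H →* Multiplicative (Fin d → ℤ_[p])) (hf : Function.Injective f)
    (hclosed : IsClosed (Set.range fun h => (f h).toAdd)) : IsSelfSimilarOfIndex H (p ^ k) := by
  let W := PadicInt.submoduleOfIsClosed (p := p) (Subgroup.toAddSubgroup' f.range) (by
    convert hclosed
    ext w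
    rfl)
  have hmem : ∀ w, w ∈ W ↔ ∃ h, f h = .ofAdd w := fun w => Iff.rfl
  have hW : W ≠ ⊥ := by
    obtain ⟨h, hh⟩ := exists_ne (1 : H)
    intro hbot
    have h1 : (f h).toAdd ∈ W := (hmem _).mpr ⟨h, rfl⟩
    rw [hbot, Submodule.mem_bot] at h1
    exact hh (hf (by rw [map_one]; exact h1))
  obtain ⟨n, ⟨e⟩⟩ := exists_linearEquiv_succ W hW
  let E : H ≃* Multiplicative W := MulEquiv.ofBijective
    ({ toFun := fun h => .ofAdd ⟨(f h).toAdd, (hmem _).mpr ⟨h, rfl⟩⟩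
       map_one' := Subtype.ext (congrArg Multiplicative.toAdd (map_one f))
       map_mul' := fun a b => Subtype.ext (congrArg Multiplicative.toAdd (map_mul f a b)) } : H →* Multiplicative W)
    ⟨fun a b hab => hf (congrArg (fun x : Multiplicative W =>
      Multiplicative.ofAdd (x.toAdd : Fin d → ℤ_[p])) hab), fun w => by
      obtain ⟨h, hh⟩ := (hmem _).mp w.toAdd.2
      exact ⟨h, Subtype.ext hh⟩⟩
  exact (isSelfSimilarOfIndex_multiplicative hk n).of_mulEquiv
    (e.toAddEquiv.toMultiplicative.trans E.symm)

end ClosedSubgroup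

/-! ### Coordinates and topology on `G^d(s)`. -/

section Metabelian

namespace MetabelianGroup

variable {p : ℕ} [Fact p.Prime] {d s : ℕ} {hs : 1 ≤ s}

/-- The element of `G^d(s)` with given vector part and exponent. -/
noncomputable def mk (hs : 1 ≤ s) (v : Fin (d - 1) → ℤ_[p]) (t : ℤ_[p]) :
    MetabelianGroup p d s hs :=
  SemidirectProduct.mk (.ofAdd v) (.ofAdd t)

/-- The vector part of an element of `G^d(s)`. -/
noncomputable def vec (g : MetabelianGroup p d s hs) : Fin (d - 1) → ℤ_[p] :=
  (SemidirectProduct.left g).toAdd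

/-- The projection of `G^d(s)` onto `ℤ_[p]`. -/
noncomputable def exponent : MetabelianGroup p d s hs →* Multiplicative ℤ_[p] :=
  SemidirectProduct.rightHom

@[ext]
theorem ext {g h : MetabelianGroup p d s hs} (hv : g.vec = h.vec)
    (ht : exponent g = exponent h) : g = h :=
  SemidirectProduct.ext hv ht

@[simp]
theorem vec_mk (v : Fin (d - 1) → ℤ_[p]) (t : ℤ_[p]) : (mk hs v t).vec = v := rfl

@[simp]
theorem exponent_mk (v : Fin (d - 1) → ℤ_[p]) (t : ℤ_[p]) :
    exponent (mk hs v t) = .ofAdd t := rfl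

@[simp]
theorem vec_one : (1 : MetabelianGroup p d s hs).vec = 0 := rfl

@[simp]
theorem vec_mul (g h : MetabelianGroup p d s hs) :
    (g * h).vec = g.vec + onePlusPowChar p s hs (exponent g).toAdd • h.vec := rfl

@[simp]
theorem vec_inv (g : MetabelianGroup p d s hs) :
    g⁻¹.vec = onePlusPowChar p s hs (-(exponent g).toAdd) • -g.vec := rfl

theorem continuous_vec_exponent : Continuous fun g : MetabelianGroup p d s hs =>
    (g.vec, (exponent g).toAdd) :=
  continuous_induced_dom

theorem continuous_vec : Continuous (vec : MetabelianGroup p d s hs → _) :=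
  continuous_vec_exponent.fst

theorem continuous_exponent :
    Continuous fun g : MetabelianGroup p d s hs => (exponent g).toAdd :=
  continuous_vec_exponent.snd

theorem continuous_mk :
    Continuous fun q : (Fin (d - 1) → ℤ_[p]) × ℤ_[p] => mk (p := p) (d := d) hs q.1 q.2 :=
  continuous_induced_rng.mpr (continuous_id :
    Continuous (id : (Fin (d - 1) → ℤ_[p]) × ℤ_[p] → _))

/-- The group `G^d(s)` is homeomorphic to `ℤ_[p] ^ (d - 1) × ℤ_[p]`. -/
noncomputable def homeomorphProd :
    MetabelianGroup p d s hs ≃ₜ (Fin (d - 1) → ℤ_[p]) × ℤ_[p] where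
  toFun g := (g.vec, (exponent g).toAdd)
  invFun q := mk hs q.1 q.2
  left_inv _ := rfl
  right_inv _ := rfl
  continuous_toFun := continuous_vec_exponent
  continuous_invFun := continuous_mk

instance : CompactSpace (MetabelianGroup p d s hs) := homeomorphProd.symm.compactSpace

instance : T2Space (MetabelianGroup p d s hs) := homeomorphProd.symm.t2Space

instance : TotallyDisconnectedSpace (MetabelianGroup p d s hs) :=
  homeomorphProd.isEmbedding.isTotallyDisconnected_range.mp
    (isTotallyDisconnected_of_totallyDisconnectedSpace _)

instance : IsTopologicalGroup (MetabelianGroup p d s hs) where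
  continuous_mul := by
    refine continuous_mk.comp (f := fun q : _ × _ => ((q.1 * q.2).vec, (exponent (q.1 * q.2)).toAdd))
      (Continuous.prodMk ?_ ?_)
    · simp only [vec_mul]
      exact (continuous_vec.comp continuous_fst).add (((continuous_onePlusPowChar p s hs).comp
        (continuous_exponent.comp continuous_fst)).smul (continuous_vec.comp continuous_snd))
    · simp only [map_mul, toAdd_mul]
      exact (continuous_exponent.comp continuous_fst).add (continuous_exponent.comp continuous_snd)
  continuous_inv := by
    refine continuous_mk.comp (f := fun q => ((q⁻¹).vec, (exponent q⁻¹).toAdd))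
      (Continuous.prodMk ?_ ?_)
    · simp only [vec_inv]
      exact ((continuous_onePlusPowChar p s hs).comp continuous_exponent.neg).smul continuous_vec.neg
    · simp only [map_inv, toAdd_inv]
      exact continuous_exponent.neg

end MetabelianGroup

end Metabelian

/-! ### Closed subgroups of `G^d(s)`. -/

section MetabelianSubgroup

namespace MetabelianGroup

variable {p : ℕ} [Fact p.Prime] {d s : ℕ} {hs : 1 ≤ s}

theorem mk_zero_mul (v w : Fin (d - 1) → ℤ_[p]) :
    mk hs v 0 * mk hs w 0 = mk (p := p) (d := d) hs (v + w) 0 := by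
  ext <;> simp

theorem conj_mk_zero (g : MetabelianGroup p d s hs) (v : Fin (d - 1) → ℤ_[p]) :
    g * mk hs v 0 * g⁻¹ = mk hs (onePlusPowChar p s hs (exponent g).toAdd • v) 0 := by
  rw [mul_inv_eq_iff_eq_mul]
  refine MetabelianGroup.ext ?_ ?_
  · simp [add_comm]
  · simp

/-- The homomorphism `v ↦ (v, 0)`. -/
noncomputable def inl : Multiplicative (Fin (d - 1) → ℤ_[p]) →* MetabelianGroup p d s hs where
  toFun v := mk hs v.toAdd 0
  map_one' := rfl
  map_mul' _ _ := (mk_zero_mul _ _).symm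

theorem continuous_inl :
    Continuous fun v : Fin (d - 1) → ℤ_[p] => (inl (.ofAdd v) : MetabelianGroup p d s hs) :=
  continuous_mk.comp (Continuous.prodMk continuous_id continuous_const)

/-- Commuting with `g` means that `χ - 1` kills the vector of `c`, where `χ` is the scalar of `g`;
`χ ≠ 1` by injectivity of the character. -/
theorem eq_one_of_commute {g c : MetabelianGroup p d s hs} (hg : exponent g ≠ 1)
    (hc : exponent c = 1) (h : c * g = g * c) : c = 1 := by
  have hv := congrArg vec h
  rw [vec_mul, vec_mul, hc, toAdd_one, AddChar.map_zero_eq_one, one_smul, add_comm,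
    add_right_inj, eq_comm, ← sub_eq_zero] at hv
  have h1 : (onePlusPowChar p s hs (exponent g).toAdd - 1) • c.vec = 0 := by
    rw [sub_smul, one_smul, hv]
  rcases smul_eq_zero.mp h1 with h1 | h1
  · exact absurd (eq_zero_of_onePlusPowChar_eq_one (sub_eq_zero.mp h1)) hg
  · exact MetabelianGroup.ext h1 hc

/-- The exponents of the elements of a closed subgroup form a submodule of `ℤ_[p]`. -/
noncomputable def exponents (H : Subgroup (MetabelianGroup p d s hs))
    (hH : IsClosed (H : Set (MetabelianGroup p d s hs))) : Submodule ℤ_[p] ℤ_[p] :=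
  PadicInt.submoduleOfIsClosed (Subgroup.toAddSubgroup' (H.map exponent)) (by
    convert (hH.isCompact.image continuous_exponent).isClosed
    ext w
    rfl)

theorem mem_exponents {H : Subgroup (MetabelianGroup p d s hs)}
    {hH : IsClosed (H : Set (MetabelianGroup p d s hs))} {t : ℤ_[p]} :
    t ∈ exponents H hH ↔ ∃ h ∈ H, exponent h = .ofAdd t := Iff.rfl

/-- The vectors `v` such that `(v, 0)` lies in a given closed subgroup. -/
noncomputable def vectors (H : Subgroup (MetabelianGroup p d s hs))
    (hH : IsClosed (H : Set (MetabelianGroup p d s hs))) :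
    Submodule ℤ_[p] (Fin (d - 1) → ℤ_[p]) :=
  PadicInt.submoduleOfIsClosed (Subgroup.toAddSubgroup' (H.comap inl))
    (hH.preimage continuous_inl)

theorem mem_vectors {H : Subgroup (MetabelianGroup p d s hs)}
    {hH : IsClosed (H : Set (MetabelianGroup p d s hs))} {v : Fin (d - 1) → ℤ_[p]} :
    v ∈ vectors H hH ↔ mk hs v 0 ∈ H := Iff.rfl

/-- A closed subgroup `H` is the semidirect product of `H ∩ ℤ_[p] ^ (d - 1)` and the centralizer
in `H` of an element whose exponent has minimal valuation. -/
theorem isSelfSimilarOfIndex_subgroup_of_ne {k : ℕ} (hk : 1 ≤ k)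
    (H : Subgroup (MetabelianGroup p d s hs))
    (hH : IsClosed (H : Set (MetabelianGroup p d s hs)))
    (hD : exponents H hH ≠ ⊥) (hW : vectors H hH ≠ ⊥) : IsSelfSimilarOfIndex H (p ^ k) := by
  obtain ⟨n, ⟨e⟩⟩ := exists_linearEquiv_succ _ hW
  obtain ⟨t, ht⟩ := (IsPrincipalIdealRing.principal (exponents H hH)).principal
  obtain ⟨g, hg, hgt⟩ := mem_exponents.mp (ht ▸ Submodule.mem_span_singleton_self t)
  have hg1 : exponent g ≠ 1 := by
    intro h1
    have ht0 : t = 0 := Multiplicative.ofAdd.injective (hgt.symm.trans h1)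
    exact hD (by rw [ht, ht0, Submodule.span_zero_singleton])
  -- `C` is a closed complement to the vector part: `exponent` is injective on it by
  -- `eq_one_of_commute`. Since `g ∈ C` and its exponent `t` generates the exponents of `H`, every
  -- exponent of `H` occurs in `C`.
  let C : Subgroup (MetabelianGroup p d s hs) := Subgroup.centralizer {g} ⊓ H
  have hC : IsClosed (C : Set (MetabelianGroup p d s hs)) :=
    (Set.isClosed_centralizer {g}).inter hH
  have hcomm : ∀ c : C, (c : MetabelianGroup p d s hs) * g = g * c := fun c =>
    (Subgroup.mem_centralizer_singleton_iff.mp c.2.1)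
  have hDC : exponents H hH ≤ exponents C hC := by
    rw [ht, Submodule.span_singleton_le_iff_mem]
    exact mem_exponents.mpr ⟨g, ⟨Subgroup.mem_centralizer_singleton_iff.mpr rfl, hg⟩, hgt⟩
  let f : C →* Multiplicative ℤ_[p] := exponent.comp C.subtype
  have hf1 : ∀ c, f c = 1 → c = 1 := fun c hc => Subtype.ext (eq_one_of_commute hg1 hc (hcomm c))
  let fn : Multiplicative (Fin (n + 1) → ℤ_[p]) →* H :=
    { toFun := fun v => ⟨mk hs (e v.toAdd) 0, mem_vectors.mp (e v.toAdd).2⟩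
      map_one' := Subtype.ext (by simp; rfl)
      map_mul' := fun v w => Subtype.ext (by simp [mk_zero_mul]) }
  let F : Multiplicative (Fin (n + 1) → ℤ_[p]) ⋊[(scalarAction p (n + 1) s hs).comp f] C →* H :=
    SemidirectProduct.lift fn (Subgroup.inclusion inf_le_right) fun c => by
      refine MonoidHom.ext fun v => Subtype.ext ?_
      refine Eq.trans ?_ (conj_mk_zero (c : MetabelianGroup p d s hs) (e v.toAdd)).symm
      exact congrArg (fun w : vectors H hH => mk hs (w : Fin (d - 1) → ℤ_[p]) 0)
        (e.map_smul _ v.toAdd)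
  have hF : ∀ v c, (F ⟨v, c⟩ : MetabelianGroup p d s hs) =
      mk (p := p) (d := d) hs (e v.toAdd) 0 * (c : MetabelianGroup p d s hs) :=
    fun _ _ => rfl
  refine (isSelfSimilarOfIndex_scalarExtension hk f fun c hc =>
    hf1 c (eq_zero_of_onePlusPowChar_eq_one hc)).of_mulEquiv (MulEquiv.ofBijective F ⟨?_, ?_⟩)
  · rw [injective_iff_map_eq_one]
    rintro ⟨v, c⟩ h
    have h1 : mk hs (e v.toAdd : Fin (d - 1) → ℤ_[p]) 0 * (c : MetabelianGroup p d s hs) = 1 := by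
      rw [← hF, h]
      rfl
    have hc : c = 1 := hf1 c (show exponent (c : MetabelianGroup p d s hs) = 1 by
      simpa using congrArg exponent h1)
    subst hc
    have hv : (e v.toAdd : Fin (d - 1) → ℤ_[p]) = 0 := by simpa using congrArg vec h1
    have hv' : v.toAdd = 0 := by simpa using hv
    exact SemidirectProduct.ext (Multiplicative.toAdd.injective hv') rfl
  · rintro ⟨h, hh⟩
    -- Choosing `c ∈ C` with the exponent of `h` leaves `h * c⁻¹` in the vector part.
    obtain ⟨c, hc, hch⟩ := mem_exponents.mp
      (hDC (mem_exponents.mpr ⟨h, hh, (ofAdd_toAdd _).symm⟩))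
    have hexp : exponent (h * c⁻¹) = 1 := by
      rw [map_mul, map_inv, hch, ofAdd_toAdd, mul_inv_cancel]
    have hmk : mk hs (h * c⁻¹).vec 0 = h * c⁻¹ := MetabelianGroup.ext rfl hexp.symm
    have hmem : (h * c⁻¹).vec ∈ vectors H hH := by
      rw [mem_vectors, hmk]
      exact H.mul_mem hh (H.inv_mem hc.2)
    refine ⟨⟨.ofAdd (e.symm ⟨_, hmem⟩), ⟨c, hc⟩⟩, Subtype.ext ?_⟩
    rw [hF, toAdd_ofAdd, LinearEquiv.apply_symm_apply, hmk, inv_mul_cancel_right]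

/-- If all exponents vanish, `vec` embeds `H` in `ℤ_[p] ^ (d - 1)`; if the vector part is trivial,
`exponent` embeds `H` in `ℤ_[p]`. Compactness makes both images closed. -/
theorem isSelfSimilarOfIndex_subgroup {k : ℕ} (hk : 1 ≤ k)
    (H : Subgroup (MetabelianGroup p d s hs))
    (hH : IsClosed (H : Set (MetabelianGroup p d s hs))) (hne : H ≠ ⊥) :
    IsSelfSimilarOfIndex H (p ^ k) := by
  have : Nontrivial H := (Subgroup.nontrivial_iff_ne_bot H).mpr hne
  have : CompactSpace H := isCompact_iff_compactSpace.mp hH.isCompact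
  by_cases hD : exponents H hH = ⊥
  · have hexp : ∀ h ∈ H, exponent h = 1 := fun h hh => by
      have : (exponent h).toAdd ∈ exponents H hH := mem_exponents.mpr ⟨h, hh, rfl⟩
      rwa [hD, Submodule.mem_bot] at this
    refine isSelfSimilarOfIndex_of_injective hk
      ({ toFun := fun h => .ofAdd h.1.vec
         map_one' := rfl
         map_mul' := fun a b => by simp [hexp a.1 a.2] } :
        H →* Multiplicative (Fin (d - 1) → ℤ_[p])) (fun a b hab => ?_) ?_
    · exact Subtype.ext (MetabelianGroup.ext hab (by rw [hexp _ a.2, hexp _ b.2]))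
    · exact (isCompact_range (continuous_vec.comp continuous_subtype_val)).isClosed
  by_cases hW : vectors H hH = ⊥
  · refine isSelfSimilarOfIndex_of_injective (d := 1) hk
      ({ toFun := fun h => .ofAdd fun _ => (exponent h.1).toAdd
         map_one' := rfl
         map_mul' := fun a b => by
          simp
          rfl } : H →* Multiplicative (Fin 1 → ℤ_[p])) ?_ ?_
    · rw [injective_iff_map_eq_one]
      intro h hh
      have hexp : exponent h.1 = 1 := congrFun hh 0
      have hmk : mk hs h.1.vec 0 = h.1 := MetabelianGroup.ext rfl hexp.symm
      have hmem : h.1.vec ∈ vectors H hH := by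
        rw [mem_vectors, hmk]
        exact h.2
      rw [hW, Submodule.mem_bot] at hmem
      exact Subtype.ext (MetabelianGroup.ext hmem hexp)
    · exact (isCompact_range (continuous_pi fun _ =>
        continuous_exponent.comp continuous_subtype_val)).isClosed
  · exact isSelfSimilarOfIndex_subgroup_of_ne hk H hH hD hW

end MetabelianGroup

end MetabelianSubgroup

/-! ### Pro-`p` property and topological generation. -/

section ProP

theorem IsProPGroup.of_continuousMulEquiv {p : ℕ} {G G' : Type*} [Group G] [TopologicalSpace G]
    [Group G'] [TopologicalSpace G'] (f : G' ≃ₜ* G) (h : IsProPGroup p G) :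
    IsProPGroup p G' where
  isTopologicalGroup := by
    have := h.isTopologicalGroup
    exact f.toHomeomorph.isInducing.topologicalGroup f
  compactSpace := by
    have := h.compactSpace
    exact f.toHomeomorph.symm.compactSpace
  t2Space := by
    have := h.t2Space
    exact f.toHomeomorph.symm.t2Space
  totallyDisconnectedSpace := by
    have := h.totallyDisconnectedSpace
    exact f.toHomeomorph.isEmbedding.isTotallyDisconnected_range.mp
      (isTotallyDisconnected_of_totallyDisconnectedSpace _)
  index_eq_pow U hU hopen := by
    obtain ⟨n, hn⟩ := h.index_eq_pow (U.comap (f.symm : G →* G')) (hU.comap _)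
      (hopen.preimage f.symm.continuous)
    exact ⟨n, by rw [← hn, Subgroup.index_comap_of_surjective _ f.symm.surjective]⟩

variable {p : ℕ} [Fact p.Prime] {G G' : Type*} [Group G] [TopologicalSpace G] [Group G']
  [TopologicalSpace G']

theorem IsProPGroup.of_forall_pow_mem [IsTopologicalGroup G] [CompactSpace G] [T2Space G]
    [TotallyDisconnectedSpace G]
    (h : ∀ U : Subgroup G, U.Normal → IsOpen (U : Set G) → ∀ g : G, ∃ n : ℕ, g ^ p ^ n ∈ U) :
    IsProPGroup p G := by
  refine ⟨inferInstance, inferInstance, inferInstance, inferInstance, fun U hU hopen => ?_⟩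
  have : Finite (G ⧸ U) := U.quotient_finite_of_isOpen hopen
  have hP : IsPGroup p (G ⧸ U) := by
    intro q
    obtain ⟨g, rfl⟩ := QuotientGroup.mk_surjective q
    obtain ⟨n, hn⟩ := h U hU hopen g
    exact ⟨n, (QuotientGroup.eq_one_iff _).mpr hn⟩
  exact IsPGroup.iff_card.mp hP

theorem IsTopologicallyFG.of_continuousMulEquiv (f : G ≃ₜ* G') (h : IsTopologicallyFG G) :
    IsTopologicallyFG G' := by
  classical
  obtain ⟨S, hS⟩ := h
  refine ⟨S.image f, ?_⟩
  have h1 := f.surjective.denseRange.dense_image f.continuous hS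
  rw [Finset.coe_image]
  convert h1
  exact congrArg (fun K : Subgroup G' => (K : Set G'))
    (MonoidHom.map_closure (f : G →* G') (S : Set G)).symm

theorem isTopologicallyFG_of_closed_eq_top [IsTopologicalGroup G] {S : Set G} (hS : S.Finite)
    (h : ∀ E : Subgroup G, IsClosed (E : Set G) → S ⊆ E → E = ⊤) : IsTopologicallyFG G := by
  refine ⟨hS.toFinset, ?_⟩
  rw [hS.coe_toFinset, dense_iff_closure_eq, ← Subgroup.topologicalClosure_coe,
    h _ (Subgroup.isClosed_topologicalClosure _)
      (Subgroup.subset_closure.trans (Subgroup.le_topologicalClosure _)), Subgroup.coe_top]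

variable {M : Type*} [AddCommGroup M] [Module ℤ_[p] M] [TopologicalSpace M]
  [ContinuousSMul ℤ_[p] M] {f : Multiplicative M →* G}

/-- `p ^ n • v` tends to `0`, so its image `f v ^ p ^ n` eventually enters `U`. -/
theorem exists_pow_mem_of_isOpen (hf : Continuous fun v : M => f (.ofAdd v)) {U : Subgroup G}
    (hU : IsOpen (U : Set G)) (v : Multiplicative M) : ∃ n : ℕ, f v ^ p ^ n ∈ U := by
  have h1 : Tendsto (fun n : ℕ => (p : ℤ_[p]) ^ n • v.toAdd) atTop (𝓝 0) := by
    have h2 := (padicInt_tendsto_pow_pow p le_rfl).smul_const v.toAdd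
    simpa only [pow_one, zero_smul] using h2
  have hmem : ((fun v : M => f (.ofAdd v)) ⁻¹' (U : Set G)) ∈ 𝓝 (0 : M) :=
    (hU.preimage hf).mem_nhds (by simp)
  obtain ⟨n, hn⟩ := (h1.eventually hmem).exists
  refine ⟨n, ?_⟩
  rw [← map_pow]
  have hpow : v ^ p ^ n = .ofAdd ((p : ℤ_[p]) ^ n • v.toAdd) := by
    refine Multiplicative.toAdd.injective ?_
    rw [toAdd_pow, toAdd_ofAdd, ← Nat.cast_smul_eq_nsmul ℤ_[p], Nat.cast_pow]
  rw [hpow]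
  exact hn

theorem mem_of_isClosed_of_span_eq_top (hf : Continuous fun v : M => f (.ofAdd v))
    {E : Subgroup G} (hE : IsClosed (E : Set G)) {S : Set M} (hS : Submodule.span ℤ_[p] S = ⊤)
    (h : ∀ v ∈ S, f (.ofAdd v) ∈ E) (v : Multiplicative M) : f v ∈ E := by
  have hle : Submodule.span ℤ_[p] S ≤ PadicInt.submoduleOfIsClosed
      (Subgroup.toAddSubgroup' (E.comap f)) (hE.preimage hf) := Submodule.span_le.mpr h
  exact (hS ▸ hle) (Submodule.mem_top (x := v.toAdd))

theorem isProPGroup_multiplicative (d : ℕ) :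
    IsProPGroup p (Multiplicative (Fin d → ℤ_[p])) :=
  have : TotallyDisconnectedSpace (Multiplicative (Fin d → ℤ_[p])) :=
    inferInstanceAs (TotallyDisconnectedSpace (Fin d → ℤ_[p]))
  .of_forall_pow_mem fun _ _ hU g =>
    exists_pow_mem_of_isOpen (f := MonoidHom.id (Multiplicative (Fin d → ℤ_[p])))
      continuous_ofAdd hU g

theorem isTopologicallyFG_multiplicative (d : ℕ) :
    IsTopologicallyFG (Multiplicative (Fin d → ℤ_[p])) := by
  refine isTopologicallyFG_of_closed_eq_top
    (S := Set.range fun i => .ofAdd (Pi.basisFun ℤ_[p] (Fin d) i)) (Set.finite_range _)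
    fun E hE hS => (Subgroup.eq_top_iff' E).mpr fun v => ?_
  refine mem_of_isClosed_of_span_eq_top (f := MonoidHom.id (Multiplicative (Fin d → ℤ_[p])))
    continuous_ofAdd hE (Pi.basisFun ℤ_[p] (Fin d)).span_eq ?_ v
  rintro _ ⟨i, rfl⟩
  exact hS ⟨i, rfl⟩

namespace MetabelianGroup

variable {d s : ℕ} {hs : 1 ≤ s}

/-- The homomorphism `t ↦ (0, t)`. -/
noncomputable def inr : Multiplicative ℤ_[p] →* MetabelianGroup p d s hs where
  toFun t := mk hs 0 t.toAdd
  map_one' := rfl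
  map_mul' _ _ := by ext <;> simp

theorem continuous_inr :
    Continuous fun t : ℤ_[p] => (inr (.ofAdd t) : MetabelianGroup p d s hs) :=
  continuous_mk.comp (Continuous.prodMk continuous_const continuous_id)

theorem inl_vec_mul_inr_exponent (g : MetabelianGroup p d s hs) :
    inl (.ofAdd g.vec) * inr (exponent g) = g := by
  change mk hs g.vec 0 * mk hs 0 (exponent g).toAdd = g
  ext <;> simp

/-- Modulo `U`, a `p`-power of `g` loses its exponent part, and a further `p`-power kills the
remaining vector. -/
theorem isProPGroup : IsProPGroup p (MetabelianGroup p d s hs) := by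
  refine .of_forall_pow_mem fun U hU hopen g => ?_
  obtain ⟨n, hn⟩ := exists_pow_mem_of_isOpen (p := p) continuous_inr hopen (exponent g)
  obtain ⟨l, hl⟩ := exists_pow_mem_of_isOpen (p := p) continuous_inl hopen (.ofAdd (g ^ p ^ n).vec)
  refine ⟨n + l, ?_⟩
  rw [← map_pow, ← map_pow] at hn
  rw [← QuotientGroup.eq_one_iff] at hn hl ⊢
  rw [pow_add, pow_mul, ← inl_vec_mul_inr_exponent (g ^ p ^ n), QuotientGroup.mk_pow,
    QuotientGroup.mk_mul, hn, mul_one, ← QuotientGroup.mk_pow, hl]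

theorem isTopologicallyFG : IsTopologicallyFG (MetabelianGroup p d s hs) := by
  refine isTopologicallyFG_of_closed_eq_top
    (S := insert (inr (.ofAdd 1)) (Set.range fun i =>
      inl (.ofAdd (Pi.basisFun ℤ_[p] (Fin (d - 1)) i))))
    ((Set.finite_range _).insert _) fun E hE hS => (Subgroup.eq_top_iff' E).mpr fun g => ?_
  rw [Set.insert_subset_iff, Set.range_subset_iff] at hS
  rw [← inl_vec_mul_inr_exponent g]
  refine E.mul_mem (mem_of_isClosed_of_span_eq_top continuous_inl hE
    (Pi.basisFun ℤ_[p] (Fin (d - 1))).span_eq ?_ _) (mem_of_isClosed_of_span_eq_top (S := {1})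
    continuous_inr hE Ideal.span_one ?_ _)
  · rintro _ ⟨i, rfl⟩
    exact hS.2 i
  · rintro _ rfl
    exact hS.1

instance : Nontrivial (MetabelianGroup p d s hs) :=
  ⟨inr (.ofAdd 1), 1, fun h => one_ne_zero (congrArg (fun g => (exponent g).toAdd) h)⟩

end MetabelianGroup

end ProP

/-! ### Transport along the given isomorphisms. -/

section StronglyHereditary

variable {p k : ℕ} [Fact p.Prime] {G : Type*} [Group G] [TopologicalSpace G]

theorem isStronglyHereditarilySelfSimilar_of_multiplicative (hk : 1 ≤ k) {d : ℕ} (hd : 1 ≤ d)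
    (f : G ≃ₜ* Multiplicative (Fin d → ℤ_[p])) : IsStronglyHereditarilySelfSimilar p k G := by
  have hpro := (isProPGroup_multiplicative d).of_continuousMulEquiv f
  have hcompact := hpro.compactSpace
  have : Nonempty (Fin d) := ⟨⟨0, hd⟩⟩
  have hnontriv : Nontrivial G :=
    have : Nontrivial (Multiplicative (Fin d → ℤ_[p])) :=
      inferInstanceAs (Nontrivial (Fin d → ℤ_[p]))
    f.toEquiv.nontrivial
  refine ⟨hpro, (isTopologicallyFG_multiplicative d).of_continuousMulEquiv f.symm, ?_,
    fun H hH hne _ => ?_⟩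
  · exact isSelfSimilarOfIndex_of_injective hk f.toMulEquiv.toMonoidHom f.injective
      (isCompact_range (continuous_toAdd.comp f.continuous)).isClosed
  · have : Nontrivial H := (Subgroup.nontrivial_iff_ne_bot H).mpr hne
    have : CompactSpace H := isCompact_iff_compactSpace.mp hH.isCompact
    exact isSelfSimilarOfIndex_of_injective hk (f.toMulEquiv.toMonoidHom.comp H.subtype)
      (f.injective.comp Subtype.val_injective)
      (isCompact_range (continuous_toAdd.comp (f.continuous.comp continuous_subtype_val))).isClosed

theorem isStronglyHereditarilySelfSimilar_of_metabelianGroup (hk : 1 ≤ k) {d s : ℕ} {hs : 1 ≤ s}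
    (f : G ≃ₜ* MetabelianGroup p d s hs) : IsStronglyHereditarilySelfSimilar p k G := by
  refine ⟨MetabelianGroup.isProPGroup.of_continuousMulEquiv f,
    MetabelianGroup.isTopologicallyFG.of_continuousMulEquiv f.symm, ?_, fun H hH hne _ => ?_⟩
  · exact (MetabelianGroup.isSelfSimilarOfIndex_subgroup (hs := hs) hk ⊤ isClosed_univ
      top_ne_bot).of_mulEquiv (Subgroup.topEquiv.trans f.symm.toMulEquiv)
  · refine (MetabelianGroup.isSelfSimilarOfIndex_subgroup hk (H.map f.toMulEquiv.toMonoidHom)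
      (f.toHomeomorph.isClosedMap _ hH) ?_).of_mulEquiv
      (H.equivMapOfInjective f.toMulEquiv.toMonoidHom f.injective).symm
    rwa [Ne, Subgroup.map_eq_bot_iff_of_injective _ f.injective]

end StronglyHereditary

theorem mainTheorem8 (p : ℕ) [Fact p.Prime] (k : ℕ) (hk : 1 ≤ k)
    (G : Type*) [Group G] [TopologicalSpace G]
    (hG : (∃ d : ℕ, 1 ≤ d ∧ Nonempty (G ≃ₜ* Multiplicative (Fin d → ℤ_[p]))) ∨
      (∃ (d s : ℕ) (hs : 1 ≤ s), 2 ≤ d ∧ (p = 2 → 2 ≤ s) ∧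
        Nonempty (G ≃ₜ* MetabelianGroup p d s hs))) :
    IsStronglyHereditarilySelfSimilar p k G := by
  obtain ⟨d, hd, ⟨f⟩⟩ | ⟨d, s, hs, -, -, ⟨f⟩⟩ := hG
  · exact isStronglyHereditarilySelfSimilar_of_multiplicative hk hd f
  · exact isStronglyHereditarilySelfSimilar_of_metabelianGroup hk f
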